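/- Let $b\ge 2$ be an integer and let $\mathbb{T}_b$ be the rooted tree in which every vertex has exactly $b$ children (so the root has degree $b$ and every other vertex has degree $b+1$). For $p\in[0,1]$ consider bond percolation on $\mathbb{T}_b$ with parameter $p$: each edge is declared open with probability $p$ and closed otherwise, independently of all other edges. Let $X$ be the set of vertices that lie in no infinite open cluster (connected component of the graph formed by all vertices and the open edges), regarded as the subgraph of $\mathbb{T}_b$ induced by $X$ (with all edges of $\mathbb{T}_b$, open or closed, between vertices of $X$). Let $\rho_b(p)$ be the probability that $X$ has an infinite connected component, and let $$p_{\mathrm{fin}}(\mathbb{T}_b)=\inf\{p\in[0,1] : \rho_b(p)=0\}.$$ Then $$p_{\mathrm{fin}}(\mathbb{T}_b)=\frac{b^{b/(b-1)}-b}{b^{b/(b-1)}-1}\qquad\text{and}\qquad \rho_b\bigl(p_{\mathrm{fin}}(\mathbb{T}_b)\bigr)=0 .$$ That is, at the critical value there is almost surely no infinite component of $X$. In particular $p_{\mathrm{fin}}(\mathbb{T}_2)=\tfrac23$. -/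

import Mathlib

open MeasureTheory ProbabilityTheory unitInterval

namespace FiniteClusters

section Percolation

variable {V : Type*} (G : SimpleGraph V)

/-- A bond configuration on `G`: the edge `e` is open if `ω e = true` and closed otherwise. -/
abbrev Config : Type _ := G.edgeSet → Bool

/-- The law of bond percolation on `G` with parameter `p`: the product measure on configurations
under which each edge is open with probability `p` and closed with probability `1 - p`. -/
noncomputable def bondMeasure (p : I) : Measure (Config G) :=
  Measure.infinitePi fun _ : G.edgeSet => bernoulliMeasure true false p

variable {G}

/-- The graph with all vertices of `G` and precisely the open edges of the configuration. Its
connected components are the open clusters. -/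
def openGraph (ω : Config G) : SimpleGraph V :=
  SimpleGraph.fromEdgeSet {e | ∃ he : e ∈ G.edgeSet, ω ⟨e, he⟩ = true}

/-- The set `X` of vertices that lie in no infinite open cluster. -/
def finiteClusterSet (ω : Config G) : Set V :=
  {x | ((openGraph ω).connectedComponentMk x).supp.Finite}

/-- The event that `X`, with all edges of `G` (open or closed) between its vertices, has an
infinite connected component. -/
def HasInfiniteFiniteClusterComponent (ω : Config G) : Prop :=
  ∃ c : (G.induce (finiteClusterSet ω)).ConnectedComponent, c.supp.Infinite

end Percolation

/-- The rooted tree in which every vertex has exactly `b` children. The vertices are the finite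
words over an alphabet of `b` letters, the root is the empty word, and the children of the word `v`
are the words `a :: v`. So the root has degree `b` and all other vertices have degree `b + 1`. -/
def tree (b : ℕ) : SimpleGraph (List (Fin b)) where
  Adj v w := (∃ a, w = a :: v) ∨ (∃ a, v = a :: w)
  symm := ⟨fun _ _ h => h.symm⟩
  loopless := ⟨by rintro v (⟨a, h⟩ | ⟨a, h⟩) <;> simpa using congrArg List.length h⟩

/-- The probability that `X` has an infinite component, for bond percolation on the rooted tree. -/
noncomputable def rho (b : ℕ) (p : I) : ℝ :=
  (bondMeasure (tree b) p).real {ω | HasInfiniteFiniteClusterComponent ω}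

/-- The critical value `inf {p ∈ [0, 1] : rho b p = 0}`. -/
noncomputable def pfin (b : ℕ) : I := sInf {p : I | rho b p = 0}

end FiniteClusters

/-! Call a vertex dying if its open cluster among its descendants is finite. If every vertex on a
path from the root is dying, all of them lie in `X`: a closed edge above a vertex confines its
cluster to its descendants, an open one puts it in its parent's cluster. Conversely an infinite
component of `X` is a tree of dying vertices below its top vertex. By shift invariance and a
countable union over that vertex, `rho b p > 0` iff `L > 0`, where `L` is the probability that dying
paths of every length start at the root.

Let `q = dieProb` and `s = branchDieProb = 1 - p + p * q`; independence of the branches gives `q = s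
^ b`. The probabilities of dying paths of length `n` satisfy `x (n + 1) = s ^ b - (s - x n) ^ b`
(`dyingReachProb_succ`). This recursion is strictly concave with slope `b * s ^ (b - 1)` at 0, so `L
= 0` iff `s ≤ t`, where `b * t ^ (b - 1) = 1`; strictness covers the critical case. Finally `s = 1 -
p + p * s ^ b`, and `s = t` solves this exactly when `p = (1 - t) / (1 - t ^ b)`. -/

namespace FiniteClusters

/-- Labellings of the edges of the tree, the pair `(a, v)` standing for the edge from `v` to its
child `a :: v`. -/
abbrev Labels (b : ℕ) : Type := Fin b × List (Fin b) → Bool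

/-- The labelling of the subtree of the descendants of `v`. -/
def shift {b : ℕ} (v : List (Fin b)) (η : Labels b) : Labels b := fun e => η (e.1, e.2 ++ v)

/-- All edges on the path from the root to `u` are open. -/
def OpenPath {b : ℕ} (η : Labels b) : List (Fin b) → Prop
  | [] => True
  | a :: u => η (a, u) = true ∧ OpenPath η u

/-- The open cluster of the root reaches level `n`. -/
def Reaches {b : ℕ} (n : ℕ) (η : Labels b) : Prop :=
  ∃ u : List (Fin b), u.length = n ∧ OpenPath η u

/-- The open cluster of the root does not reach all levels. -/
def Dies {b : ℕ} (η : Labels b) : Prop := ∃ n, ¬ Reaches n η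

/-- Every vertex on the path from the root to `u` has a finite cluster of descendants. -/
def DyingPath {b : ℕ} (η : Labels b) : List (Fin b) → Prop
  | [] => Dies η
  | a :: u => Dies (shift (a :: u) η) ∧ DyingPath η u

/-- Some path of length `n` from the root satisfies `DyingPath`. -/
def DyingReaches {b : ℕ} (n : ℕ) (η : Labels b) : Prop :=
  ∃ u : List (Fin b), u.length = n ∧ DyingPath η u

/-! ### Recursions at the root for dying and for dying paths -/

section Deterministic

variable {b : ℕ} {η : Labels b}

lemma shift_nil : shift [] η = η := by
  funext e; simp [shift]

lemma shift_shift (u v : List (Fin b)) : shift u (shift v η) = shift (u ++ v) η := by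
  funext e; simp [shift]

lemma openPath_append_singleton (u : List (Fin b)) (a : Fin b) :
    OpenPath η (u ++ [a]) ↔ η (a, []) = true ∧ OpenPath (shift [a] η) u := by
  induction u with
  | nil => simp [OpenPath]
  | cons c u ih =>
    simp only [List.cons_append, OpenPath, ih, shift]
    tauto

lemma dyingPath_append_singleton (u : List (Fin b)) (a : Fin b) :
    DyingPath η (u ++ [a]) ↔ Dies η ∧ DyingPath (shift [a] η) u := by
  induction u with
  | nil => simp [DyingPath, and_comm]
  | cons c u ih =>
    simp only [List.cons_append, DyingPath, ih, shift_shift]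
    tauto

lemma DyingPath.dies_root {u : List (Fin b)} (h : DyingPath η u) : Dies η := by
  induction u with
  | nil => exact h
  | cons c u ih => exact ih h.2

lemma DyingPath.dies {u : List (Fin b)} (h : DyingPath η u) : Dies (shift u η) := by
  cases u with
  | nil => rwa [shift_nil]
  | cons c u => exact h.1

lemma exists_length_succ {P : List (Fin b) → Prop} {n : ℕ} :
    (∃ u : List (Fin b), u.length = n + 1 ∧ P u) ↔
      ∃ a, ∃ u : List (Fin b), u.length = n ∧ P (u ++ [a]) := by
  constructor
  · rintro ⟨u, hu, h⟩
    obtain rfl | ⟨u', a, rfl⟩ := List.eq_nil_or_concat' u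
    · simp at hu
    · exact ⟨a, u', by simpa using hu, h⟩
  · rintro ⟨a, u, hu, h⟩
    exact ⟨u ++ [a], by simp [hu], h⟩

lemma reaches_zero : Reaches 0 η := ⟨[], rfl, trivial⟩

lemma reaches_succ {n : ℕ} :
    Reaches (n + 1) η ↔ ∃ a, η (a, []) = true ∧ Reaches n (shift [a] η) := by
  unfold Reaches
  rw [exists_length_succ]
  simp only [openPath_append_singleton]
  refine exists_congr fun a => ⟨fun ⟨u, h, h', h''⟩ => ⟨h', u, h, h''⟩,
    fun ⟨h', u, h, h''⟩ => ⟨u, h, h', h''⟩⟩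

lemma antitone_reaches : Antitone fun n => Reaches n η := by
  refine antitone_nat_of_succ_le fun n => ?_
  rintro ⟨_ | ⟨a, u⟩, hu, h⟩
  · simp at hu
  · exact ⟨u, by simpa using hu, h.2⟩

lemma antitone_dyingReaches : Antitone fun n => DyingReaches n η := by
  refine antitone_nat_of_succ_le fun n => ?_
  rintro ⟨_ | ⟨a, u⟩, hu, h⟩
  · simp at hu
  · exact ⟨u, by simpa using hu, h.2⟩

lemma not_reaches_succ {n : ℕ} :
    ¬ Reaches (n + 1) η ↔ ∀ a, η (a, []) = false ∨ ¬ Reaches n (shift [a] η) := by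
  rw [reaches_succ]
  push Not
  refine forall_congr' fun a => ?_
  cases η (a, []) <;> simp

lemma dies_iff : Dies η ↔ ∀ a, η (a, []) = false ∨ Dies (shift [a] η) := by
  constructor
  · rintro ⟨n, hn⟩ a
    have := fun h => hn (antitone_reaches n.le_succ h)
    exact (not_reaches_succ.1 this a).imp_right fun h => ⟨n, h⟩
  · intro h
    have : ∀ a, ∃ n, η (a, []) = false ∨ ¬ Reaches n (shift [a] η) := fun a => by
      obtain h | ⟨n, h⟩ := h a
      · exact ⟨0, .inl h⟩
      · exact ⟨n, .inr h⟩
    choose n hn using this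
    -- Finitely many children, so one level bounds all their clusters.
    refine ⟨Finset.univ.sup n + 1, not_reaches_succ.2 fun a => (hn a).imp_right fun h h' => h ?_⟩
    exact antitone_reaches (Finset.le_sup (Finset.mem_univ a)) h'

lemma dyingReaches_zero : DyingReaches 0 η ↔ Dies η := by
  simp [DyingReaches, DyingPath]

lemma DyingReaches.dies {n : ℕ} (h : DyingReaches n η) : Dies η :=
  let ⟨_, _, h⟩ := h
  h.dies_root

lemma dyingReaches_succ {n : ℕ} :
    DyingReaches (n + 1) η ↔ Dies η ∧ ∃ a, DyingReaches n (shift [a] η) := by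
  unfold DyingReaches
  rw [exists_length_succ]
  simp only [dyingPath_append_singleton]
  constructor
  · rintro ⟨a, u, h, h', h''⟩
    exact ⟨h', a, u, h, h''⟩
  · rintro ⟨h', a, u, h, h''⟩
    exact ⟨a, u, h, h', h''⟩

end Deterministic

/-! ### Measurability of the events -/

section Measurability

variable {b : ℕ}

lemma measurable_shift (v : List (Fin b)) : Measurable (shift v) := by
  unfold shift; fun_prop

lemma measurableSet_openPath (u : List (Fin b)) : MeasurableSet {η | OpenPath η u} := by
  induction u with
  | nil => simp [OpenPath]
  | cons a u ih =>
    exact (measurableSet_eq_fun (measurable_pi_apply (a, u)) measurable_const).inter ih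

lemma measurableSet_reaches (n : ℕ) : MeasurableSet {η : Labels b | Reaches n η} := by
  have : {η : Labels b | Reaches n η} =
      ⋃ u : List (Fin b), {η | u.length = n} ∩ {η | OpenPath η u} := by
    ext; simp [Reaches]
  rw [this]
  exact .iUnion fun u => (MeasurableSet.const _).inter (measurableSet_openPath u)

lemma measurableSet_dies : MeasurableSet {η : Labels b | Dies η} := by
  have : {η : Labels b | Dies η} = ⋃ n, {η | Reaches n η}ᶜ := by
    ext; simp [Dies]
  rw [this]
  exact .iUnion fun n => (measurableSet_reaches n).compl

lemma measurableSet_dyingPath (u : List (Fin b)) : MeasurableSet {η | DyingPath η u} := by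
  induction u with
  | nil => exact measurableSet_dies
  | cons a u ih => exact (measurable_shift (a :: u) measurableSet_dies).inter ih

lemma measurableSet_dyingReaches (n : ℕ) : MeasurableSet {η : Labels b | DyingReaches n η} := by
  have : {η : Labels b | DyingReaches n η} =
      ⋃ u : List (Fin b), {η | u.length = n} ∩ {η | DyingPath η u} := by
    ext; simp [DyingReaches]
  rw [this]
  exact .iUnion fun u => (MeasurableSet.const _).inter (measurableSet_dyingPath u)

end Measurability

/-! ### Independence of the branches and the resulting recursions -/

section Law

variable (b : ℕ) (p : I)

/-- The law of independent edge labels, each `true` with probability `p`. -/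
noncomputable abbrev labelMeasure : Measure (Labels b) :=
  Measure.infinitePi fun _ => bernoulliMeasure true false p

/-- The edge above the vertex `u ++ [a]`. -/
def branchEdge {b : ℕ} (e : Fin b × List (Fin b)) : Fin b × List (Fin b) :=
  match e with
  | (a, []) => (a, [])
  | (a, c :: u) => (c, u ++ [a])

lemma branchEdge_injective : Function.Injective (branchEdge (b := b)) := by
  rintro ⟨a, _ | ⟨c, u⟩⟩ ⟨a', _ | ⟨c', u'⟩⟩ h <;> simp_all [branchEdge]

lemma map_shift (v : List (Fin b)) : (labelMeasure b p).map (shift v) = labelMeasure b p := by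
  refine Measure.map_infinitePi_infinitePi_of_inj
    (P := fun _ : Fin b × List (Fin b) => bernoulliMeasure true false p)
    (f := fun e : Fin b × List (Fin b) => (e.1, e.2 ++ v)) ?_
  rintro ⟨a, u⟩ ⟨a', u'⟩ h
  simpa using h

/-- `branchEdge` indexes the edges of branch `a` by words, `[]` being the edge at the root, so
reindexing along this injection and currying splits the product measure by branch. -/
lemma map_branch :
    (labelMeasure b p).map (fun η a u => η (branchEdge (a, u))) =
      Measure.pi fun _ : Fin b => Measure.infinitePi fun _ : List (Fin b) =>
        bernoulliMeasure true false p := by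
  rw [← Measure.infinitePi_eq_pi, ← Measure.infinitePi_map_curry,
    ← Measure.map_infinitePi_infinitePi_of_inj
      (P := fun _ : Fin b × List (Fin b) => bernoulliMeasure true false p)
      (branchEdge_injective b), Measure.map_map (by fun_prop) (by fun_prop)]
  rfl

lemma map_root_tail :
    (Measure.infinitePi fun _ : List (Fin b) => bernoulliMeasure true false p).map
      (fun ξ => (ξ [], fun e : Fin b × List (Fin b) => ξ (e.1 :: e.2))) =
      (bernoulliMeasure true false p).prod (labelMeasure b p) := by
  set ν := Measure.infinitePi fun _ : List (Fin b) => bernoulliMeasure true false p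
  have hi : iIndepFun (fun (w : List (Fin b)) (ξ : List (Fin b) → Bool) => ξ w) ν :=
    iIndepFun_infinitePi (X := fun _ x => x) (fun _ => measurable_id)
  have h : IndepFun (fun ξ : List (Fin b) → Bool => ξ [])
      (fun ξ (e : Fin b × List (Fin b)) => ξ (e.1 :: e.2)) ν := by
    have := indep_iSup_of_disjoint (fun w => (measurable_pi_apply w).comap_le) hi
      (S := {[]}) (T := {[]}ᶜ) disjoint_compl_right
    refine indep_of_indep_of_le_left (indep_of_indep_of_le_right this ?_) ?_
    · simp only [MeasurableSpace.pi, MeasurableSpace.comap_iSup, MeasurableSpace.comap_comp]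
      refine iSup_le fun e => ?_
      exact le_iSup₂_of_le (e.1 :: e.2) (by simp) le_rfl
    · exact le_iSup₂_of_le [] rfl le_rfl
  rw [h.map_prod_eq_prod_map_map (Measurable.aemeasurable (by fun_prop))
    (Measurable.aemeasurable (by fun_prop))]
  congr 1
  · exact Measure.infinitePi_map_eval _ _
  · refine Measure.map_infinitePi_infinitePi_of_inj
      (P := fun _ : List (Fin b) => bernoulliMeasure true false p)
      (f := fun e : Fin b × List (Fin b) => e.1 :: e.2) ?_
    rintro ⟨a, u⟩ ⟨a', u'⟩ h
    simpa using h

/-- The branches at the root are independent copies of an edge and a tree. -/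
lemma labelMeasure_real_forall_branch {A : Set (Bool × Labels b)} (hA : MeasurableSet A) :
    (labelMeasure b p).real {η | ∀ a, (η (a, []), shift [a] η) ∈ A} =
      ((bernoulliMeasure true false p).prod (labelMeasure b p)).real A ^ b := by
  have hm : Measurable fun ξ : List (Fin b) → Bool =>
    (ξ [], fun e : Fin b × List (Fin b) => ξ (e.1 :: e.2)) := by fun_prop
  have : {η : Labels b | ∀ a, (η (a, []), shift [a] η) ∈ A} =
      (fun η a u => η (branchEdge (a, u))) ⁻¹' Set.univ.pi fun _ : Fin b =>
        (fun ξ : List (Fin b) → Bool =>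
          (ξ [], fun e : Fin b × List (Fin b) => ξ (e.1 :: e.2))) ⁻¹' A := by
    ext η; simp [branchEdge]; rfl
  rw [this, ← map_measureReal_apply (by fun_prop) (.univ_pi fun _ => hm hA), map_branch,
    measureReal_def, Measure.pi_pi, ← map_root_tail, map_measureReal_apply hm hA]
  simp [measureReal_def]

lemma prod_real_closed_or {D : Set (Labels b)} (hD : MeasurableSet D) :
    ((bernoulliMeasure true false p).prod (labelMeasure b p)).real
      {x | x.1 = false ∨ x.2 ∈ D} = 1 - p + p * (labelMeasure b p).real D := by
  have : {x : Bool × Labels b | x.1 = false ∨ x.2 ∈ D} =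
      ({false} ×ˢ Set.univ) ∪ ({true} ×ˢ D) := by
    ext ⟨x, η⟩; cases x <;> simp
  rw [this, measureReal_union _ (.prod (.singleton _) hD), measureReal_prod_prod,
    measureReal_prod_prod, bernoulliMeasure_real_apply_of_notMem_of_mem,
    bernoulliMeasure_real_apply_of_mem_of_notMem]
  · simp
  all_goals simp [Set.disjoint_left]

/-- The probability that the cluster of the root is finite. -/
noncomputable def dieProb : ℝ := (labelMeasure b p).real {η | Dies η}

/-- The probability that the edge at the root of a branch is closed or the cluster below finite. -/
noncomputable def branchDieProb : ℝ := 1 - p + p * dieProb b p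

/-- The probability that `n` generations of vertices with finite clusters exist. -/
noncomputable def dyingReachProb (n : ℕ) : ℝ := (labelMeasure b p).real {η | DyingReaches n η}

lemma dieProb_eq : dieProb b p = branchDieProb b p ^ b := by
  rw [branchDieProb, dieProb, ← prod_real_closed_or b p measurableSet_dies,
    ← labelMeasure_real_forall_branch]
  · congr 1; ext η; exact dies_iff
  · exact (measurableSet_eq_fun measurable_fst measurable_const).union
      (measurable_snd measurableSet_dies)

/-- Extinction is the least fixed point: the probabilities of dying by level `n` are the iterates
from 0 of a monotone map, and they increase to `dieProb`. -/
lemma dieProb_le {x : ℝ} (hx : 0 ≤ x) (h : (1 - p + p * x) ^ b ≤ x) : dieProb b p ≤ x := by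
  have hn : ∀ n, (labelMeasure b p).real {η | ¬ Reaches n η} ≤ x := by
    intro n
    induction n with
    | zero => simpa [reaches_zero] using hx
    | succ n ih =>
      have e : (labelMeasure b p).real {η | ¬ Reaches (n + 1) η} =
          (1 - p + p * (labelMeasure b p).real {η | ¬ Reaches n η}) ^ b := by
        have hm : MeasurableSet {η : Labels b | ¬ Reaches n η} := (measurableSet_reaches n).compl
        rw [← prod_real_closed_or b p hm, ← labelMeasure_real_forall_branch]
        · congr 1; ext η; exact not_reaches_succ
        · exact (measurableSet_eq_fun measurable_fst measurable_const).union
            (measurable_snd hm)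
      rw [e]
      have h1 := p.2.1
      have h2 := mul_nonneg h1 (measureReal_nonneg (μ := labelMeasure b p)
        (s := {η | ¬ Reaches n η}))
      exact (pow_le_pow_left₀ (by linarith [p.2.2]) (by gcongr) b).trans h
  have hU : {η : Labels b | Dies η} = ⋃ n, {η | ¬ Reaches n η} := by
    ext; simp [Dies]
  have ht := tendsto_measure_iUnion_atTop (μ := labelMeasure b p)
    (s := fun n => {η : Labels b | ¬ Reaches n η})
    (fun m n hmn η h h' => h (antitone_reaches hmn h'))
  rw [← hU] at ht
  exact le_of_tendsto' ((ENNReal.tendsto_toReal (measure_ne_top _ _)).comp ht) hn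

lemma dyingReachProb_zero : dyingReachProb b p 0 = branchDieProb b p ^ b := by
  rw [← dieProb_eq, dyingReachProb, dieProb]
  simp only [dyingReaches_zero]

/-- The event fails inside `Dies` when every branch is closed or dying, yet carries no dying path of
length `n`; each branch does so independently with probability `s - x n`. -/
lemma dyingReachProb_succ (n : ℕ) : dyingReachProb b p (n + 1) =
    branchDieProb b p ^ b - (branchDieProb b p - dyingReachProb b p n) ^ b := by
  have hF : MeasurableSet {x : Bool × Labels b | x.1 = false ∨ x.2 ∈ {η | Dies η}} :=
    (measurableSet_eq_fun measurable_fst measurable_const).union (measurable_snd measurableSet_dies)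
  have hS : MeasurableSet {x : Bool × Labels b | DyingReaches n x.2} :=
    measurable_snd (measurableSet_dyingReaches n)
  have hSp : ((bernoulliMeasure true false p).prod (labelMeasure b p)).real
      {x | DyingReaches n x.2} = dyingReachProb b p n := by
    have : {x : Bool × Labels b | DyingReaches n x.2} =
      Set.univ ×ˢ {η | DyingReaches n η} := by ext; simp
    rw [this, measureReal_prod_prod, dyingReachProb]
    simp
  have key : {η : Labels b | DyingReaches (n + 1) η} = {η | Dies η} \
      {η | ∀ a, (η (a, []), shift [a] η) ∈
        {x | x.1 = false ∨ x.2 ∈ {η | Dies η}} \ {x | DyingReaches n x.2}} := by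
    ext η
    simp only [Set.mem_ofPred_eq, Set.mem_sdiff, dyingReaches_succ, not_forall, not_and, not_not]
    refine and_congr_right fun h => exists_congr fun a => ?_
    have := dies_iff.1 h a
    tauto
  have hsub : {η : Labels b | ∀ a, (η (a, []), shift [a] η) ∈
        {x | x.1 = false ∨ x.2 ∈ {η | Dies η}} \ {x | DyingReaches n x.2}} ⊆ {η | Dies η} :=
    fun η h => dies_iff.2 fun a => (h a).1
  have hmeas : MeasurableSet {η : Labels b | ∀ a, (η (a, []), shift [a] η) ∈
        {x | x.1 = false ∨ x.2 ∈ {η | Dies η}} \ {x | DyingReaches n x.2}} := by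
    rw [Set.ofPred_forall]
    exact .iInter fun a => ((measurable_pi_apply _).prodMk (measurable_shift _)) (hF.diff hS)
  rw [dyingReachProb, key, measureReal_sdiff hsub hmeas,
    labelMeasure_real_forall_branch b p (hF.diff hS), measureReal_sdiff _ hS, hSp,
    prod_real_closed_or b p measurableSet_dies, ← dieProb, ← branchDieProb, dieProb_eq]
  exact fun x hx => .inr (DyingReaches.dies hx)

lemma tendsto_dyingReachProb : Filter.Tendsto (dyingReachProb b p) Filter.atTop
    (nhds ((labelMeasure b p).real {η | ∀ n, DyingReaches n η})) := by
  have ht := tendsto_measure_iInter_atTop (μ := labelMeasure b p)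
    (s := fun n => {η : Labels b | DyingReaches n η})
    (fun n => (measurableSet_dyingReaches n).nullMeasurableSet)
    (fun m n hmn η h => antitone_dyingReaches hmn h) ⟨0, measure_ne_top _ _⟩
  rw [← Set.ofPred_forall] at ht
  exact (ENNReal.tendsto_toReal (measure_ne_top _ _)).comp ht

end Law

end FiniteClusters

namespace FiniteClusters

/-! ### From clusters of the percolation graph to dying paths -/

section Graph

variable {b : ℕ}

lemma mem_edgeSet_cons (a : Fin b) (v : List (Fin b)) : s(v, a :: v) ∈ (tree b).edgeSet :=
  (SimpleGraph.mem_edgeSet _).2 (.inl ⟨a, rfl⟩)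

/-- The labelling of the pairs `(a, v)` given by a configuration. -/
def labels (ω : Config (tree b)) : Labels b := fun e => ω ⟨s(e.2, e.1 :: e.2), mem_edgeSet_cons _ _⟩

lemma map_labels (p : I) : (bondMeasure (tree b) p).map labels = labelMeasure b p := by
  refine Measure.map_infinitePi_infinitePi_of_inj
    (P := fun _ : (tree b).edgeSet => bernoulliMeasure true false p)
    (f := fun e : Fin b × List (Fin b) => ⟨s(e.2, e.1 :: e.2), mem_edgeSet_cons _ _⟩) ?_
  rintro ⟨a, u⟩ ⟨a', u'⟩ h
  simp only [Subtype.mk.injEq, Sym2.eq_iff] at h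
  obtain ⟨rfl, h⟩ | ⟨h, h'⟩ := h
  · simpa using h
  · have h1 := congrArg List.length h
    have h2 := congrArg List.length h'
    simp only [List.length_cons] at h1 h2
    omega

lemma measurable_labels : Measurable (labels (b := b)) := by
  unfold labels; fun_prop

variable {ω : Config (tree b)}

lemma openGraph_adj_cons {a : Fin b} {v : List (Fin b)} :
    (openGraph ω).Adj v (a :: v) ↔ labels ω (a, v) = true := by
  simp only [openGraph, SimpleGraph.fromEdgeSet_adj]
  refine ⟨fun h => h.1.2, fun h => ⟨⟨mem_edgeSet_cons a v, h⟩, fun h' => ?_⟩⟩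
  simpa using congrArg List.length h'

lemma openGraph_adj {v w : List (Fin b)} (h : (openGraph ω).Adj v w) :
    (∃ a, w = a :: v ∧ labels ω (a, v) = true) ∨ ∃ a, v = a :: w ∧ labels ω (a, w) = true := by
  have h' := h
  simp only [openGraph, SimpleGraph.fromEdgeSet_adj] at h'
  obtain ⟨⟨he, -⟩, -⟩ := h'
  obtain ⟨a, rfl⟩ | ⟨a, rfl⟩ := (SimpleGraph.mem_edgeSet _).1 he
  · exact .inl ⟨a, rfl, openGraph_adj_cons.1 h⟩
  · exact .inr ⟨a, rfl, openGraph_adj_cons.1 h.symm⟩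

lemma OpenPath.reachable {u v : List (Fin b)} (h : OpenPath (shift v (labels ω)) u) :
    (openGraph ω).Reachable v (u ++ v) := by
  induction u with
  | nil => rfl
  | cons a u ih => exact (ih h.2).trans (openGraph_adj_cons.2 h.1).reachable

/-- By `hv` the edge above `v`, if any, is closed, so the cluster cannot leave upwards. -/
lemma exists_openPath_of_reachable {v w : List (Fin b)}
    (hv : ∀ a v', v = a :: v' → labels ω (a, v') = false) (h : (openGraph ω).Reachable v w) :
    ∃ u, w = u ++ v ∧ OpenPath (shift v (labels ω)) u := by
  rw [SimpleGraph.reachable_iff_reflTransGen] at h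
  induction h with
  | refl => exact ⟨[], rfl, trivial⟩
  | tail _ hxy ih =>
    obtain ⟨u, rfl, hu⟩ := ih
    obtain ⟨a, rfl, ha⟩ | ⟨a, h, ha⟩ := openGraph_adj hxy
    · exact ⟨a :: u, rfl, ha, hu⟩
    · cases u with
      | nil => simp [hv a _ h] at ha
      | cons c u =>
        obtain ⟨rfl, rfl⟩ := List.cons_eq_cons.1 h
        exact ⟨u, rfl, hu.2⟩

lemma mem_finiteClusterSet {v : List (Fin b)} :
    v ∈ finiteClusterSet ω ↔ {w | (openGraph ω).Reachable v w}.Finite := by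
  have : ((openGraph ω).connectedComponentMk v).supp = {w | (openGraph ω).Reachable v w} := by
    ext w
    simp [SimpleGraph.ConnectedComponent.mem_supp_iff, SimpleGraph.reachable_comm]
  rw [finiteClusterSet, Set.mem_ofPred_eq, this]

lemma mem_finiteClusterSet_of_reachable {v w : List (Fin b)} (h : (openGraph ω).Reachable v w)
    (hv : v ∈ finiteClusterSet ω) : w ∈ finiteClusterSet ω := by
  rw [mem_finiteClusterSet] at hv ⊢
  exact hv.subset fun x hx => h.trans hx

lemma exists_length_eq_of_infinite {S : Set (List (Fin b))} (hS : S.Infinite)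
    (h : ∀ a u, a :: u ∈ S → u ∈ S) (n : ℕ) : ∃ u ∈ S, u.length = n := by
  by_contra! hn
  refine hS ((List.finite_length_lt (Fin b) n).subset fun u hu => ?_)
  by_contra hlt
  simp only [Set.mem_ofPred_eq, not_lt] at hlt
  have : ∀ k u, u ∈ S → u.length = n + k → False := by
    intro k
    induction k with
    | zero => exact fun u hu h' => hn u hu h'
    | succ k ih =>
      rintro (_ | ⟨a, u⟩) hu h'
      · simp at h'
      · exact ih u (h a u hu) (by simp at h'; omega)
  exact this (u.length - n) u hu (by omega)

lemma dies_iff_finite {η : Labels b} : Dies η ↔ {u | OpenPath η u}.Finite := by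
  constructor
  · rintro ⟨n, hn⟩
    refine (List.finite_length_lt (Fin b) n).subset fun u hu => ?_
    by_contra hlt
    exact hn (antitone_reaches (not_lt.1 hlt) ⟨u, rfl, hu⟩)
  · intro h
    by_contra hd
    simp only [Dies, not_exists, not_not] at hd
    refine Set.infinite_of_forall_exists_gt (α := ℕ) (s := List.length '' {u | OpenPath η u})
      (fun n => ?_) (h.image _)
    obtain ⟨u, hu, hp⟩ := hd (n + 1)
    exact ⟨_, ⟨u, hp, rfl⟩, by omega⟩

lemma dies_of_mem_finiteClusterSet {v : List (Fin b)} (hv : v ∈ finiteClusterSet ω) :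
    Dies (shift v (labels ω)) := by
  rw [mem_finiteClusterSet] at hv
  refine dies_iff_finite.2 (Set.Finite.of_finite_image (f := (· ++ v)) (hv.subset ?_)
    fun x _ y _ h => by simpa using h)
  rintro _ ⟨u, hu, rfl⟩
  exact OpenPath.reachable hu

lemma mem_finiteClusterSet_of_dies {v : List (Fin b)}
    (hv : ∀ a v', v = a :: v' → labels ω (a, v') = false) (h : Dies (shift v (labels ω))) :
    v ∈ finiteClusterSet ω := by
  rw [mem_finiteClusterSet]
  refine ((dies_iff_finite.1 h).image (· ++ v)).subset fun w hw => ?_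
  obtain ⟨u, rfl, hu⟩ := exists_openPath_of_reachable hv hw
  exact ⟨u, hu, rfl⟩

lemma DyingPath.mem_finiteClusterSet {u : List (Fin b)} (h : DyingPath (labels ω) u) :
    u ∈ finiteClusterSet ω := by
  induction u with
  | nil => exact mem_finiteClusterSet_of_dies (by simp) h.dies
  | cons a u ih =>
    cases ha : labels ω (a, u) with
    | true =>
      exact mem_finiteClusterSet_of_reachable (openGraph_adj_cons.2 ha).reachable (ih h.2)
    | false =>
      refine mem_finiteClusterSet_of_dies (fun a' u' e => ?_) h.dies
      obtain ⟨rfl, rfl⟩ := List.cons_eq_cons.1 e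
      exact ha

lemma DyingPath.reachable {u : List (Fin b)} (h : DyingPath (labels ω) u)
    (h0 : [] ∈ finiteClusterSet ω) :
    ((tree b).induce (finiteClusterSet ω)).Reachable ⟨[], h0⟩ ⟨u, h.mem_finiteClusterSet⟩ := by
  induction u with
  | nil => rfl
  | cons a u ih =>
    refine (ih h.2).trans (SimpleGraph.Adj.reachable ?_)
    exact .inl ⟨a, rfl⟩

lemma hasInfinite_of_forall_dyingReaches (h : ∀ n, DyingReaches n (labels ω)) :
    HasInfiniteFiniteClusterComponent ω := by
  have h0 : [] ∈ finiteClusterSet ω :=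
    DyingPath.mem_finiteClusterSet (dyingReaches_zero.1 (h 0) : DyingPath (labels ω) [])
  refine ⟨SimpleGraph.connectedComponentMk _ ⟨[], h0⟩, fun hfin => ?_⟩
  refine Set.infinite_of_forall_exists_gt (α := ℕ)
    (s := (fun x => x.1.length) '' _) (fun n => ?_) (hfin.image _)
  obtain ⟨u, hu, hp⟩ := h (n + 1)
  refine ⟨_, ⟨⟨u, hp.mem_finiteClusterSet⟩, ?_, rfl⟩, by simp [hu]⟩
  exact SimpleGraph.ConnectedComponent.sound (hp.reachable h0).symm

lemma exists_forall_dyingReaches_of_hasInfinite (h : HasInfiniteFiniteClusterComponent ω) :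
    ∃ v, ∀ n, DyingReaches n (shift v (labels ω)) := by
  obtain ⟨c, hc⟩ := h
  -- The top vertex of the component: walks inside the component never go above it.
  obtain ⟨x, hx, hmin⟩ := WellFounded.has_min
    (measure fun y : finiteClusterSet ω => y.1.length).wf c.supp hc.nonempty
  have hP : ∀ y ∈ c.supp, ∃ u, y.1 = u ++ x.1 ∧ DyingPath (shift x.1 (labels ω)) u := by
    intro y hy
    have hxy := SimpleGraph.ConnectedComponent.exact (hx.trans hy.symm)
    rw [SimpleGraph.reachable_iff_reflTransGen] at hxy
    induction hxy with
    | refl => exact ⟨[], rfl, dies_of_mem_finiteClusterSet x.2⟩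
    | @tail y z _ hyz ih =>
      obtain ⟨u, hu, hp⟩ := ih ((SimpleGraph.ConnectedComponent.sound hyz.reachable).trans hy)
      obtain ⟨a, h⟩ | ⟨a, h⟩ : (∃ a, z.1 = a :: y.1) ∨ ∃ a, y.1 = a :: z.1 := hyz
      · refine ⟨a :: u, by rw [h, hu]; rfl, ?_, hp⟩
        rw [shift_shift, List.cons_append, ← hu, ← h]
        exact dies_of_mem_finiteClusterSet z.2
      · cases u with
        | nil =>
          refine absurd ?_ (hmin z hy)
          have := congrArg List.length (hu.symm.trans h)
          simp only [List.nil_append, List.length_cons] at this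
          change z.1.length < x.1.length
          omega
        | cons c u =>
          obtain ⟨rfl, h'⟩ := List.cons_eq_cons.1 (hu.symm.trans h)
          exact ⟨u, h'.symm, hp.2⟩
  have hS : {u | DyingPath (shift x.1 (labels ω)) u}.Infinite := by
    refine fun hfin => hc (Set.Finite.of_finite_image (f := Subtype.val)
      ((hfin.image (· ++ x.1)).subset ?_) Subtype.val_injective.injOn)
    rintro _ ⟨y, hy, rfl⟩
    obtain ⟨u, hu, hp⟩ := hP y hy
    exact ⟨u, hp, hu.symm⟩
  refine ⟨x.1, fun n => ?_⟩
  obtain ⟨u, hu, hn⟩ := exists_length_eq_of_infinite hS (fun a u h => h.2) n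
  exact ⟨u, hn, hu⟩

end Graph

end FiniteClusters

namespace FiniteClusters

/-! ### Tangent bounds for powers and the critical root -/

section Analysis

lemma sub_pow_sub_lt {n : ℕ} (hn : 2 ≤ n) {s y : ℝ} (hy : 0 ≤ y) (hys : y < s) :
    s ^ n - y ^ n < n * s ^ (n - 1) * (s - y) := by
  rw [← geom_sum₂_mul]
  refine mul_lt_mul_of_pos_right ?_ (sub_pos.2 hys)
  have : (n : ℝ) * s ^ (n - 1) = ∑ i ∈ Finset.range n, s ^ (n - 1) := by simp
  rw [this]
  refine Finset.sum_lt_sum (fun i hi => ?_) ⟨0, Finset.mem_range.2 (by omega), ?_⟩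
  · have : n - 1 = i + (n - 1 - i) := by have := Finset.mem_range.1 hi; omega
    conv_rhs => rw [this, pow_add]
    have := hy.trans hys.le
    gcongr
  · simpa using pow_lt_pow_left₀ hys hy (by omega)

lemma le_sub_pow {n : ℕ} {s y : ℝ} (hy : 0 ≤ y) (hys : y ≤ s) :
    n * y ^ (n - 1) * (s - y) ≤ s ^ n - y ^ n := by
  rw [← geom_sum₂_mul]
  refine mul_le_mul_of_nonneg_right ?_ (sub_nonneg.2 hys)
  have : (n : ℝ) * y ^ (n - 1) = ∑ i ∈ Finset.range n, y ^ (n - 1) := by simp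
  rw [this]
  refine Finset.sum_le_sum fun i hi => ?_
  have : n - 1 = i + (n - 1 - i) := by have := Finset.mem_range.1 hi; omega
  conv_lhs => rw [this, pow_add]
  gcongr

/-- The number `t` with `b * t ^ (b - 1) = 1`. -/
noncomputable def critRoot (b : ℕ) : ℝ := (b : ℝ) ^ (-(1 / ((b : ℝ) - 1)))

variable {b : ℕ} (hb : 2 ≤ b)
include hb

lemma critRoot_pos : 0 < critRoot b := Real.rpow_pos_of_pos (by positivity) _

lemma critRoot_lt_one : critRoot b < 1 := by
  have h : (2 : ℝ) ≤ b := by exact_mod_cast hb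
  exact Real.rpow_lt_one_of_one_lt_of_neg (by linarith)
    (neg_lt_zero.2 (one_div_pos.2 (by linarith)))

lemma mul_critRoot_pow : (b : ℝ) * critRoot b ^ (b - 1) = 1 := by
  have h : (2 : ℝ) ≤ b := by exact_mod_cast hb
  rw [critRoot, ← Real.rpow_natCast, ← Real.rpow_mul (by linarith), Nat.cast_sub (by omega),
    Nat.cast_one, neg_mul, one_div, inv_mul_cancel₀ (by linarith), Real.rpow_neg_one,
    mul_inv_cancel₀ (by linarith)]

lemma rpow_eq_inv_critRoot_pow : (b : ℝ) ^ ((b : ℝ) / ((b : ℝ) - 1)) = (critRoot b ^ b)⁻¹ := by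
  have h : (2 : ℝ) ≤ b := by exact_mod_cast hb
  rw [critRoot, ← Real.rpow_natCast, ← Real.rpow_mul (by linarith), ← Real.rpow_neg (by linarith)]
  congr 1
  field_simp

lemma mul_critRoot_pow_self : (b : ℝ) * critRoot b ^ b = critRoot b := by
  obtain ⟨n, rfl⟩ : ∃ n, b = n + 1 := ⟨b - 1, by omega⟩
  have := mul_critRoot_pow hb
  rw [Nat.add_sub_cancel] at this
  rw [pow_succ, ← mul_assoc, this, one_mul]

lemma critRoot_pow_lt_one : critRoot b ^ b < 1 :=
  pow_lt_one₀ (critRoot_pos hb).le (critRoot_lt_one hb) (by omega)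

/-- Multiply numerator and denominator by `t ^ b`, using `b * t ^ b = t`. -/
lemma critical_formula : ((b : ℝ) ^ ((b : ℝ) / ((b : ℝ) - 1)) - b) /
    ((b : ℝ) ^ ((b : ℝ) / ((b : ℝ) - 1)) - 1) = (1 - critRoot b) / (1 - critRoot b ^ b) := by
  rw [rpow_eq_inv_critRoot_pow hb]
  have h0 := pow_pos (critRoot_pos hb) b
  have h1 := critRoot_pow_lt_one hb
  have h2 := mul_critRoot_pow_self hb
  have h3 : (critRoot b ^ b)⁻¹ - 1 ≠ 0 := by
    have := (one_lt_inv₀ h0).2 h1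
    linarith
  rw [div_eq_div_iff h3 (by linarith)]
  field_simp
  linear_combination (critRoot b ^ b - 1) * h2

lemma critical_mem : (1 - critRoot b) / (1 - critRoot b ^ b) ∈ I := by
  have h0 := critRoot_pos hb
  have h1 := critRoot_lt_one hb
  have h2 := critRoot_pow_lt_one hb
  have h3 : critRoot b ^ b ≤ critRoot b := pow_le_of_le_one h0.le h1.le (by omega)
  exact ⟨div_nonneg (by linarith) (by linarith), (div_le_one (by linarith)).2 (by linarith)⟩

end Analysis

/-! ### The phase transition -/

section Critical

variable {b : ℕ} {p : I}

lemma dieProb_mem (b : ℕ) (p : I) : dieProb b p ∈ I := ⟨measureReal_nonneg, measureReal_le_one⟩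

lemma branchDieProb_mem (b : ℕ) (p : I) : branchDieProb b p ∈ I := by
  have h := dieProb_mem b p
  have := p.2.1
  have := p.2.2
  constructor <;> unfold branchDieProb <;> nlinarith [h.1, h.2]

lemma dyingReachProb_le (n : ℕ) : dyingReachProb b p n ≤ branchDieProb b p := by
  have h : dyingReachProb b p n ≤ dieProb b p := measureReal_mono fun _ h => DyingReaches.dies h
  have := dieProb_mem b p
  have := p.2.1
  have := p.2.2
  unfold branchDieProb
  nlinarith [this, (dieProb_mem b p).2]

lemma measure_forall_dyingReaches_eq_zero (hb : 2 ≤ b) (hs : branchDieProb b p ≤ critRoot b) :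
    (labelMeasure b p).real {η | ∀ n, DyingReaches n η} = 0 := by
  set L := (labelMeasure b p).real {η | ∀ n, DyingReaches n η}
  set s := branchDieProb b p
  have ht := tendsto_dyingReachProb b p
  have hLs : L ≤ s := le_of_tendsto' ht dyingReachProb_le
  have hL : L = s ^ b - (s - L) ^ b := by
    refine tendsto_nhds_unique ((Filter.tendsto_add_atTop_iff_nat 1).2 ht) ?_
    simp_rw [dyingReachProb_succ]
    exact ((ht.const_sub s).pow b).const_sub (s ^ b)
  by_contra hne
  have hpos : 0 < L := lt_of_le_of_ne measureReal_nonneg (Ne.symm hne)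
  -- A positive fixed point would give `L < b * s ^ (b - 1) * L ≤ L`.
  have h1 := sub_pow_sub_lt hb (s := s) (y := s - L) (by linarith) (by linarith)
  have h2 : (b : ℝ) * s ^ (b - 1) ≤ 1 := by
    rw [← mul_critRoot_pow hb]
    have := (branchDieProb_mem b p).1
    gcongr
  rw [← hL, sub_sub_cancel] at h1
  nlinarith

lemma measure_forall_dyingReaches_pos (hb : 2 ≤ b) (hs : critRoot b < branchDieProb b p) :
    0 < (labelMeasure b p).real {η | ∀ n, DyingReaches n η} := by
  set s := branchDieProb b p
  have h0 := critRoot_pos hb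
  have hc : s - critRoot b ≤ s ^ b - critRoot b ^ b := by
    simpa [mul_critRoot_pow hb] using le_sub_pow (n := b) h0.le hs.le
  -- The bound `s - t ≤ x n` is preserved: it gives `s - x n ≤ t`, so `x (n + 1) ≥ s ^ b - t ^ b ≥ s
  -- - t`, the tangent at `t` having slope 1.
  refine (sub_pos.2 hs).trans_le (ge_of_tendsto' (tendsto_dyingReachProb b p) fun n => ?_)
  induction n with
  | zero =>
    rw [dyingReachProb_zero]
    linarith [pow_pos h0 b]
  | succ n ih =>
    rw [dyingReachProb_succ]
    refine hc.trans (sub_le_sub_left (pow_le_pow_left₀ ?_ (by linarith) b) _)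
    exact sub_nonneg.2 (dyingReachProb_le n)

lemma rho_eq_zero (h : (labelMeasure b p).real {η | ∀ n, DyingReaches n η} = 0) :
    rho b p = 0 := by
  have hm : MeasurableSet {η : Labels b | ∀ n, DyingReaches n η} := by
    rw [Set.ofPred_forall]
    exact .iInter measurableSet_dyingReaches
  rw [measureReal_eq_zero_iff] at h
  rw [rho, measureReal_def, ENNReal.toReal_eq_zero_iff]
  left
  refine measure_mono_null (t := ⋃ v : List (Fin b),
    labels ⁻¹' (shift v ⁻¹' {η | ∀ n, DyingReaches n η})) (fun ω hω => ?_)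
    (measure_iUnion_null fun v => ?_)
  · simpa using exists_forall_dyingReaches_of_hasInfinite hω
  · rw [← Measure.map_apply measurable_labels (measurable_shift v hm), map_labels,
      ← Measure.map_apply (measurable_shift v) hm, map_shift, h]

instance (b : ℕ) (p : I) : IsProbabilityMeasure (bondMeasure (tree b) p) := by
  unfold bondMeasure; infer_instance

lemma rho_pos (h : 0 < (labelMeasure b p).real {η | ∀ n, DyingReaches n η}) :
    0 < rho b p := by
  have hm : MeasurableSet {η : Labels b | ∀ n, DyingReaches n η} := by
    rw [Set.ofPred_forall]
    exact .iInter measurableSet_dyingReaches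
  rw [← map_labels, map_measureReal_apply measurable_labels hm] at h
  exact h.trans_le (measureReal_mono fun ω hω => hasInfinite_of_forall_dyingReaches hω)

lemma branchDieProb_le_critRoot (hb : 2 ≤ b)
    (hp : (p : ℝ) = (1 - critRoot b) / (1 - critRoot b ^ b)) :
    branchDieProb b p ≤ critRoot b := by
  have h1 := critRoot_pow_lt_one hb
  have e : 1 - p + p * critRoot b ^ b = critRoot b := by
    rw [hp]
    field_simp [(by linarith : 1 - critRoot b ^ b ≠ 0)]
    ring
  have h := dieProb_le b p (pow_pos (critRoot_pos hb) b).le (by rw [e])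
  have := mul_le_mul_of_nonneg_left h p.2.1
  rw [branchDieProb]
  linarith

lemma critRoot_lt_branchDieProb (hb : 2 ≤ b)
    (hp : (p : ℝ) < (1 - critRoot b) / (1 - critRoot b ^ b)) :
    critRoot b < branchDieProb b p := by
  by_contra! hs
  have h0 := (branchDieProb_mem b p).1
  have e : branchDieProb b p = 1 - p + p * branchDieProb b p ^ b := by
    conv_lhs => rw [branchDieProb, dieProb_eq]
  generalize branchDieProb b p = s at *
  have ht := critRoot_lt_one hb
  rw [lt_div_iff₀ (by linarith [critRoot_pow_lt_one hb])] at hp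
  have g1 := mul_neg_geom_sum s b
  have g2 := mul_neg_geom_sum (critRoot b) b
  have g : ∑ i ∈ Finset.range b, s ^ i ≤ ∑ i ∈ Finset.range b, critRoot b ^ i := by gcongr
  -- Dividing the fixed point equation by `1 - s > 0` removes the trivial root `s = 1` and leaves `p
  -- * ∑ s ^ i = 1`, whereas `hp` says `p * ∑ t ^ i < 1`; this contradicts `s ≤ t`.
  have hs1 : (1 - s) * (p * ∑ i ∈ Finset.range b, s ^ i) = (1 - s) * 1 := by
    linear_combination p * g1 + e
  have hs2 := mul_left_cancel₀ (by linarith) hs1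
  rw [← g2] at hp
  have := mul_le_mul_of_nonneg_left g p.2.1
  nlinarith

theorem pfin_eq (hb : 2 ≤ b) :
    (pfin b : ℝ) = (1 - critRoot b) / (1 - critRoot b ^ b) ∧ rho b (pfin b) = 0 := by
  let pc : I := ⟨_, critical_mem hb⟩
  have h0 : rho b pc = 0 :=
    rho_eq_zero (measure_forall_dyingReaches_eq_zero hb (branchDieProb_le_critRoot hb rfl))
  have h : pfin b = pc := by
    refine IsLeast.csInf_eq ⟨h0, fun p hp => ?_⟩
    by_contra! hlt
    exact (rho_pos (measure_forall_dyingReaches_pos hb (critRoot_lt_branchDieProb hb hlt))).ne' hp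
  rw [h]
  exact ⟨rfl, h0⟩

end Critical

end FiniteClusters

theorem mainTheorem8 :
    (∀ b : ℕ, 2 ≤ b →
      ((FiniteClusters.pfin b : I) : ℝ) =
          ((b : ℝ) ^ ((b : ℝ) / ((b : ℝ) - 1)) - b) / ((b : ℝ) ^ ((b : ℝ) / ((b : ℝ) - 1)) - 1) ∧
        FiniteClusters.rho b (FiniteClusters.pfin b) = 0) ∧
      ((FiniteClusters.pfin 2 : I) : ℝ) = 2 / 3 := by
  have h : ∀ b : ℕ, 2 ≤ b →
      ((FiniteClusters.pfin b : I) : ℝ) =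
          ((b : ℝ) ^ ((b : ℝ) / ((b : ℝ) - 1)) - b) / ((b : ℝ) ^ ((b : ℝ) / ((b : ℝ) - 1)) - 1) ∧
        FiniteClusters.rho b (FiniteClusters.pfin b) = 0 := fun b hb => by
    rw [FiniteClusters.critical_formula hb]
    exact FiniteClusters.pfin_eq hb
  refine ⟨h, ?_⟩
  rw [(h 2 le_rfl).1]
  norm_num
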